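/- Let $k$ be a field, let $n\ge 1$, let $b_1,\dots,b_n$ be nonnegative integers and put $N=b_1+\dots+b_n$. Let $\mathcal M=\{0,\dots,b_1\}\times\cdots\times\{0,\dots,b_n\}$ with the componentwise (diagonal) order, let $S=k[T_v\mid v\in\mathcal M]$ with the standard grading, let $\mathcal J_{[\mathbf b]}$ be the kernel of the homomorphism of $k$-algebras $$S\to k[x_{i,j}\mid 1\le i\le n,\ 0\le j\le b_i],\qquad T_v\mapsto x_{1,v_1}x_{2,v_2}\cdots x_{n,v_n},$$ and let $R_{[\mathbf b]}=S/\mathcal J_{[\mathbf b]}$ be the Segre ring. Let $\mathcal S$ be the set of all sequences $u=(u_1,\dots,u_N)$ in which each symbol $i\in\{1,\dots,n\}$ occurs exactly $b_i$ times. For $u\in\mathcal S$ and $0\le m\le N$ let $P_m(u)=\varepsilon_{u_1}+\dots+\varepsilon_{u_m}\in\mathcal M$, where $\varepsilon_1,\dots,\varepsilon_n$ is the canonical basis of $\mathbb Z^n$. Put $$F_{(u)}=\{P_m(u)\mid 0\le m\le N\},\qquad G_{(u)}=\{P_m(u)\mid 1\le m\le N-1,\ u_m>u_{m+1}\},$$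 and let $\mathrm{desc}(u)$ be the number of $m\in\{1,\dots,N-1\}$ with $u_m>u_{m+1}$. The Simon Newcomb number $A([\mathbf b],j)$ is the number of $u\in\mathcal S$ with $\mathrm{desc}(u)=j$. (1) Let $\prec$ be the graded reverse lexicographic term order on $S$ for any total order of the variables $T_v$ that is a linear extension of the componentwise order of $\mathcal M$ or of its opposite. Let $\Delta$ be the initial complex of $\mathcal J_{[\mathbf b]}$, that is, the simplicial complex whose Stanley--Reisner ideal is the radical of the initial ideal $\mathrm{in}_\prec(\mathcal J_{[\mathbf b]})$ (the empty set is a face). Then for each $u\in\mathcal S$ the set $F_{(u)}$ is a facet of $\Delta$ and $G_{(u)}\subseteq F_{(u)}$, and $\Delta$ is the disjoint union $$\Delta=\bigsqcup_{u\in\mathcal S}[G_{(u)},F_{(u)}],\qquad [G,F]=\{H\mid G\subseteq H\subseteq F\}.$$ (2) The Hilbert--Poincaré series $P_{R_{[\mathbf b]}}(t)=\sum_{l\ge 0}\dim_k (R_{[\mathbf b]})_l\,t^l$ is $$P_{R_{[\mathbf b]}}(t)=\frac{A_{[\mathbf b]}(t)}{(1-t)^{N+1}},\qquad A_{[\mathbf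 b]}(t)=\sum_{u\in\mathcal S}t^{\mathrm{desc}(u)}=\sum_{j\ge 0}A([\mathbf b],j)\,t^j .$$ Moreover $A_{[\mathbf b]}(1)\ne 0$, so that this fraction is in lowest terms and the $h$-vector of $R_{[\mathbf b]}$ consists of the Simon Newcomb numbers $A([\mathbf b],j)$. -/

import Mathlib

open scoped Polynomial

/-! ### The graded reverse lexicographic order -/

/-- A copy of the monoid of exponent vectors `σ →₀ ℕ`, to be ordered by the graded reverse
lexicographic order attached to the order `L` of the variables. -/
def DegRevLex {σ : Type*} (_L : LinearOrder σ) : Type _ := σ →₀ ℕ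

namespace DegRevLex

variable {σ : Type*} (L : LinearOrder σ)

noncomputable instance : AddCommMonoid (DegRevLex L) :=
  inferInstanceAs (AddCommMonoid (σ →₀ ℕ))

/-- The identity map, as an additive equivalence. -/
noncomputable def toDRL : (σ →₀ ℕ) ≃+ DegRevLex L where
  toFun a := a
  invFun a := a
  left_inv _ := rfl
  right_inv _ := rfl
  map_add' _ _ := rfl

/-- The comparison key of an exponent vector: first the total degree; in case of a tie, the
exponents are compared lexicographically, starting with the smallest variable, and the result of
this comparison is reversed. -/
noncomputable def key (a : DegRevLex L) : ℕ ×ₗ (Lex (σ →₀ ℕ))ᵒᵈ :=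
  toLex (((toDRL L).symm a).degree, OrderDual.toDual (toLex ((toDRL L).symm a)))

theorem key_injective : Function.Injective (key L) := by
  intro a b h
  have h2 := congrArg (fun x => ofLex (OrderDual.ofDual (ofLex x).2)) h
  exact h2

noncomputable instance : LinearOrder (DegRevLex L) :=
  LinearOrder.lift' (key L) (key_injective L)

theorem le_iff {a b : σ →₀ ℕ} :
    toDRL L a ≤ toDRL L b ↔
      a.degree < b.degree ∨ (a.degree = b.degree ∧ toLex b ≤ toLex a) := by
  change key L (toDRL L a) ≤ key L (toDRL L b) ↔ _
  unfold key
  rw [Prod.Lex.toLex_le_toLex]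
  rfl

/-- `a` is smaller than `b` iff it has smaller total degree or, in equal degree, it has the larger
exponent at the smallest variable at which the two exponent vectors differ. -/
theorem lt_iff {a b : σ →₀ ℕ} :
    toDRL L a < toDRL L b ↔
      a.degree < b.degree ∨
        (a.degree = b.degree ∧ ∃ v, (∀ w, L.lt w v → a w = b w) ∧ b v < a v) := by
  change key L (toDRL L a) < key L (toDRL L b) ↔ _
  unfold key
  rw [Prod.Lex.toLex_lt_toLex]
  refine or_congr Iff.rfl (and_congr Iff.rfl ?_)
  change toLex b < toLex a ↔ _
  rw [Finsupp.Lex.lt_iff]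
  constructor
  · rintro ⟨v, h, h'⟩
    exact ⟨v, fun w hw => (h w hw).symm, h'⟩
  · rintro ⟨v, h, h'⟩
    exact ⟨v, fun w hw => (h w hw).symm, h'⟩

instance : IsOrderedAddMonoid (DegRevLex L) where
  add_le_add_left a b h c := by
    obtain ⟨a, rfl⟩ := (toDRL L).surjective a
    obtain ⟨b, rfl⟩ := (toDRL L).surjective b
    obtain ⟨c, rfl⟩ := (toDRL L).surjective c
    rw [← map_add, ← map_add, le_iff, map_add, map_add, toLex_add, toLex_add]
    rcases (le_iff L).1 h with h' | ⟨h1, h2⟩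
    · exact Or.inl (by omega)
    · exact Or.inr ⟨by omega, by gcongr⟩

theorem wellFoundedLT [Finite σ] : WellFoundedLT (DegRevLex L) := by
  have hfin : ∀ x : DegRevLex L, {y : DegRevLex L | y < x}.Finite := by
    intro x
    refine (Finsupp.finite_of_degree_le (σ := σ) ((toDRL L).symm x).degree).subset ?_
    intro y hy
    rcases (lt_iff L (a := y) (b := x)).1 hy with h | h
    · exact h.le
    · exact h.1.le
  refine ⟨Subrelation.wf (r := InvImage (· < ·) fun x : DegRevLex L => {y | y < x}.ncard) ?_
    (InvImage.wf _ wellFounded_lt)⟩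
  intro x y hxy
  refine Set.ncard_lt_ncard ?_ (hfin y)
  exact ⟨fun z hz => lt_trans hz hxy, fun h => lt_irrefl x (h hxy)⟩

end DegRevLex

/-- The graded reverse lexicographic term order on the monomials in the finitely many variables
`σ`, where the variables are ordered by `L`. -/
noncomputable def degRevLex {σ : Type*} [Finite σ] (L : LinearOrder σ) : MonomialOrder σ where
  syn := DegRevLex L
  toSyn := DegRevLex.toDRL L
  toSyn_monotone := by
    intro a b h
    refine (DegRevLex.le_iff L).2 ?_
    rcases h.eq_or_lt with rfl | hlt
    · exact Or.inr ⟨rfl, le_rfl⟩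
    · refine Or.inl ?_
      obtain ⟨c, rfl⟩ := exists_add_of_le h
      have hc : c ≠ 0 := by
        rintro rfl
        simp at hlt
      have : c.degree ≠ 0 := fun h0 => hc ((Finsupp.degree_eq_zero_iff c).1 h0)
      rw [map_add]
      omega
  wellFoundedLT_syn := DegRevLex.wellFoundedLT L

/-! ### Initial ideals, initial complexes and Hilbert series -/

/-- The initial ideal of `I`: the ideal generated by the leading terms of its elements. -/
noncomputable def initialIdeal {σ k : Type*} [Field k] (m : MonomialOrder σ)
    (I : Ideal (MvPolynomial σ k)) : Ideal (MvPolynomial σ k) :=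
  Ideal.span (m.leadingTerm '' (I : Set (MvPolynomial σ k)))

/-- The initial complex of `I`: the simplicial complex (the empty face included) whose
Stanley-Reisner ideal is the radical of the initial ideal. Its non-faces are thus the finite sets
of variables whose product lies in this radical. -/
def initialComplex {σ k : Type*} [Field k] (m : MonomialOrder σ)
    (I : Ideal (MvPolynomial σ k)) : Set (Finset σ) :=
  {s | ∏ v ∈ s, (MvPolynomial.X v : MvPolynomial σ k) ∉ (initialIdeal m I).radical}

/-- The Hilbert function of `S / I`, where `S` is a standard graded polynomial ring: the dimension
of the image in `S / I` of the forms of degree `l`. -/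
noncomputable def hilbertFunction {σ k : Type*} [Field k] (I : Ideal (MvPolynomial σ k))
    (l : ℕ) : ℕ :=
  Module.finrank k
    ((MvPolynomial.homogeneousSubmodule σ k l).map (Ideal.Quotient.mkₐ k I).toLinearMap)

/-- The Hilbert-Poincaré series of `S / I`. -/
noncomputable def hilbertSeries {σ k : Type*} [Field k] (I : Ideal (MvPolynomial σ k)) :
    PowerSeries ℤ :=
  PowerSeries.mk fun l => (hilbertFunction I l : ℤ)

/-- The Hilbert-Poincaré series of `S / I` is `h(t) / (1 - t) ^ d` in lowest terms, that is, with
`h(1) ≠ 0`. This determines `h` and `d`; the coefficients of `h` are the `h`-vector of `S / I`. -/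
structure IsHPolynomial {σ k : Type*} [Field k] (I : Ideal (MvPolynomial σ k)) (h : ℤ[X])
    (d : ℕ) : Prop where
  series_eq : hilbertSeries I * (1 - PowerSeries.X) ^ d = (h : PowerSeries ℤ)
  eval_one_ne_zero : h.eval 1 ≠ 0

/-! ### The Segre ring -/

/-- The set `{0, …, b₁} × ⋯ × {0, …, bₙ}`. Its partial order, that of a product, is the
componentwise one. -/
abbrev Box {n : ℕ} (b : Fin n → ℕ) : Type := (i : Fin n) → Fin (b i + 1)

/-- The Segre toric ideal: the kernel of
`k[T_v | v ∈ Box b] → k[x_{i,j} | 1 ≤ i ≤ n, 0 ≤ j ≤ b_i]`, `T_v ↦ ∏ i, x_{i,v_i}`. -/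
noncomputable def segreIdeal (k : Type*) [Field k] {n : ℕ} (b : Fin n → ℕ) :
    Ideal (MvPolynomial (Box b) k) :=
  RingHom.ker (MvPolynomial.aeval fun v : Box b =>
    ∏ i, (MvPolynomial.X ⟨i, v i⟩ : MvPolynomial ((i : Fin n) × Fin (b i + 1)) k))

/-- The order `L` of the variables is compatible with the diagonal (that is, componentwise) order:
it is a linear extension of this order or of the opposite one. -/
def IsDiagonal {n : ℕ} {b : Fin n → ℕ} (L : LinearOrder (Box b)) : Prop :=
  (∀ v w : Box b, (∀ i, v i ≤ w i) → L.le v w) ∨ (∀ v w : Box b, (∀ i, v i ≤ w i) → L.le w v)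

/-! ### Permutations of a multiset -/

/-- The sequences `(u_1, …, u_N)`, `N = b₁ + ⋯ + bₙ`, in which each symbol `i` occurs `b i`
times. Positions and symbols are numbered from `0`. -/
abbrev MultisetPerm {n : ℕ} (b : Fin n → ℕ) : Type :=
  {u : Fin (∑ i, b i) → Fin n // ∀ i, (Finset.univ.filter fun l => u l = i).card = b i}

namespace MultisetPerm

variable {n : ℕ} {b : Fin n → ℕ}

/-- The point of the box reached after `m` steps of the walk which starts at the origin and whose
step number `l` increases the coordinate `u l` by one. -/
def point (u : MultisetPerm b) (m : ℕ) : Box b := fun i =>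
  ⟨(Finset.univ.filter fun l => l.val < m ∧ u.1 l = i).card, by
    refine Nat.lt_succ_of_le ?_
    calc _ ≤ (Finset.univ.filter fun l => u.1 l = i).card :=
          Finset.card_le_card fun l hl => by
            simp only [Finset.mem_filter, Finset.mem_univ, true_and] at hl ⊢
            exact hl.2
      _ = b i := u.2 i⟩

/-- The descents of `u`: the numbers `m` with `u_m > u_{m+1}` in the numbering of positions from
`1`, hence those with `u (m - 1) > u m` in the numbering from `0`. -/
def descents (u : MultisetPerm b) : Finset ℕ :=
  (Finset.range (∑ i, b i)).filter fun m =>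
    ∃ p q : Fin (∑ i, b i), p.val + 1 = m ∧ q.val = m ∧ u.1 q < u.1 p

/-- The number of descents of `u`. -/
def desc (u : MultisetPerm b) : ℕ := u.descents.card

/-- The lattice path from `(0, …, 0)` to `(b₁, …, bₙ)` attached to `u`, both end points
included. -/
def latticePath (u : MultisetPerm b) : Finset (Box b) :=
  (Finset.range (∑ i, b i + 1)).image u.point

/-- The set of the descent points of `u`. -/
def descentPoints (u : MultisetPerm b) : Finset (Box b) :=
  u.descents.image u.point

end MultisetPerm

/-- The Simon Newcomb number: the number of multiset permutations with exactly `j` descents. -/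
def simonNewcomb {n : ℕ} (b : Fin n → ℕ) (j : ℕ) : ℕ :=
  (Finset.univ.filter fun u : MultisetPerm b => u.desc = j).card

/-- The multiset Eulerian polynomial `∑ u, t ^ desc u`. -/
noncomputable def multisetEulerian {n : ℕ} (b : Fin n → ℕ) : ℤ[X] :=
  ∑ u : MultisetPerm b, Polynomial.X ^ u.desc

/-! The parametrization sends monomials to monomials, so the fibres of the exponent map govern
everything. Replacing an incomparable pair `v`, `w` by `v ⊓ w`, `v ⊔ w` preserves the image and
lowers the monomial, so every fibre has a member supported on a chain
(`exists_isChainSupported_le`). It is the only one (`exponent_injOn`), hence the least of its fibre.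
So no leading monomial of the ideal has chain support, while each incomparable pair gives a leading
term: the initial complex is the order complex of the box (`mem_initialComplex_iff`).

Each chain `H` lies in exactly one interval. To find a path, fill the gaps of `H` with steps in
weakly increasing order of symbols, so that descents occur only at points of `H` (`exists_mem_Icc`).
Two such paths cannot separate: the one taking the larger symbol first would have to descend at a
point off the other path (`not_lt_at_first_difference`).

The chain supported monomials form a basis of the Segre ring. Those with support in the interval of
`u` contribute `t ^ desc u / (1 - t) ^ (N + 1)`, since a path has `N + 1` points, of which `desc u`
are forced into the support. -/

namespace Segre

variable {n : ℕ} {b : Fin n → ℕ}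

/-! ### The Segre parametrization on exponent vectors -/

/-- The exponent vector of `∏ i, x_{i,v_i}`. -/
noncomputable def varExponent (v : Box b) : ((i : Fin n) × Fin (b i + 1)) →₀ ℕ :=
  ∑ i, Finsupp.single ⟨i, v i⟩ 1

/-- The exponent vector of the image of the monomial `T ^ a` under the Segre parametrization. -/
noncomputable def exponent (b : Fin n → ℕ) :
    (Box b →₀ ℕ) →+ (((i : Fin n) × Fin (b i + 1)) →₀ ℕ) where
  toFun a := ∑ v, a v • varExponent v
  map_zero' := by simp
  map_add' a c := by simp [add_smul, Finset.sum_add_distrib]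

theorem varExponent_apply (v : Box b) (i : Fin n) (j : Fin (b i + 1)) :
    varExponent v ⟨i, j⟩ = if v i = j then 1 else 0 := by
  classical
  rw [varExponent, Finsupp.finsetSum_apply, Finset.sum_eq_single i]
  · simp [Finsupp.single_apply]
  · intro i' _ h
    rw [Finsupp.single_apply, if_neg]
    intro h'
    exact h (congrArg Sigma.fst h')
  · simp

theorem exponent_apply (a : Box b →₀ ℕ) (i : Fin n) (j : Fin (b i + 1)) :
    exponent b a ⟨i, j⟩ = ∑ v with v i = j, a v := by
  classical
  change (∑ v, a v • varExponent v) _ = _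
  rw [Finsupp.finsetSum_apply, Finset.sum_filter]
  exact Finset.sum_congr rfl fun v _ => by simp [varExponent_apply]

theorem exponent_single (v : Box b) (m : ℕ) :
    exponent b (Finsupp.single v m) = m • varExponent v := by
  classical
  change ∑ w, Finsupp.single v m w • varExponent w = _
  rw [Finset.sum_eq_single v]
  · simp
  · intro w _ h
    simp [h.symm]
  · simp

/-- The Segre parametrization `T_v ↦ ∏ i, x_{i,v_i}`. -/
noncomputable def param (k : Type*) [Field k] (b : Fin n → ℕ) :
    MvPolynomial (Box b) k →ₐ[k] MvPolynomial ((i : Fin n) × Fin (b i + 1)) k :=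
  MvPolynomial.aeval fun v : Box b => ∏ i, MvPolynomial.X ⟨i, v i⟩

theorem param_monomial (k : Type*) [Field k] (a : Box b →₀ ℕ) (c : k) :
    param k b (MvPolynomial.monomial a c) = MvPolynomial.monomial (exponent b a) c := by
  have hX (v : Box b) : (∏ i, MvPolynomial.X ⟨i, v i⟩ :
      MvPolynomial ((i : Fin n) × Fin (b i + 1)) k) =
      MvPolynomial.monomial (varExponent v) 1 := by
    rw [varExponent, MvPolynomial.monomial_sum_one]
    rfl
  rw [param, MvPolynomial.aeval_monomial, Finsupp.prod_fintype _ _ (by simp)]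
  simp only [hX, MvPolynomial.monomial_pow, one_pow]
  rw [← MvPolynomial.monomial_sum_one, MvPolynomial.algebraMap_eq, MvPolynomial.C_mul_monomial,
    mul_one]
  rfl

theorem coeff_param {k : Type*} [Field k] (f : MvPolynomial (Box b) k)
    (e : ((i : Fin n) × Fin (b i + 1)) →₀ ℕ) :
    (param k b f).coeff e = ∑ a ∈ f.support, if exponent b a = e then f.coeff a else 0 := by
  classical
  conv_lhs => rw [f.as_sum, map_sum]
  simp only [param_monomial, MvPolynomial.coeff_sum, MvPolynomial.coeff_monomial]

theorem mem_segreIdeal {k : Type*} [Field k] {f : MvPolynomial (Box b) k} :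
    f ∈ segreIdeal k b ↔ param k b f = 0 := Iff.rfl

/-- Every `T_v` contributes exactly one variable from row `i`, so a single row already determines
the degree. -/
theorem degree_eq_sum_exponent (i : Fin n) (a : Box b →₀ ℕ) :
    a.degree = ∑ j, exponent b a ⟨i, j⟩ := by
  classical
  simp only [exponent_apply, Finsupp.degree_eq_sum]
  exact (Finset.sum_fiberwise Finset.univ (fun v : Box b => v i) a).symm

theorem varExponent_inf_add_sup (v w : Box b) :
    varExponent (v ⊓ w) + varExponent (v ⊔ w) = varExponent v + varExponent w := by
  ext ⟨i, j⟩
  simp only [Finsupp.add_apply, varExponent_apply, Pi.inf_apply, Pi.sup_apply]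
  rcases le_total (v i) (w i) with h | h <;> simp [h, add_comm]

/-! ### Chain supported vectors as minima of the fibres -/

/-- The support of `a` is a chain. -/
def IsChainSupported (a : Box b →₀ ℕ) : Prop := IsChain (· ≤ ·) (a.support : Set (Box b))

-- For every `i`, the up-set of `v` has mass at most that of the half-space `v i ≤ w i`, which
-- depends only on the exponent. For chain support, equality holds for some `i`.
open Classical in
theorem sum_upperSet_le (hn : 0 < n) {a a' : Box b →₀ ℕ} (ha : IsChainSupported a)
    (h : exponent b a = exponent b a') (v : Box b) :
    ∑ w with v ≤ w, a' w ≤ ∑ w with v ≤ w, a w := by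
  -- Otherwise each `i` has a support element `x i` that is at least `v` in coordinate `i` but not
  -- above `v`; the largest `x i` in the chain would then be above `v` in every coordinate.
  obtain ⟨i, hi⟩ : ∃ i, ∀ w ∈ a.support, v i ≤ w i → v ≤ w := by
    by_contra! hcon
    choose x hx hxv hxn using hcon
    have : Nonempty (Fin n) := ⟨⟨0, hn⟩⟩
    have hne : (Finset.univ.image x).Nonempty := Finset.univ_nonempty.image x
    obtain ⟨y, hy, hmax⟩ := (Finset.univ.image x).exists_maximal hne
    obtain ⟨i₀, -, rfl⟩ := Finset.mem_image.1 hy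
    refine hxn i₀ fun i => (hxv i).trans ?_
    have hc : x i ≤ x i₀ := by
      rcases ha.total (hx i) (hx i₀) with h1 | h1
      · exact h1
      · exact hmax (Finset.mem_image_of_mem _ (Finset.mem_univ i)) h1
    exact hc i
  have key (c : Box b →₀ ℕ) : ∑ w with v i ≤ w i, c w =
      ∑ j with v i ≤ j, exponent b c ⟨i, j⟩ := by
    simp only [exponent_apply]
    rw [← Finset.sum_fiberwise_of_maps_to (g := fun w : Box b => w i)
      (t := Finset.univ.filter fun j => v i ≤ j) (by simp)]
    refine Finset.sum_congr rfl fun j hj => Finset.sum_congr ?_ fun _ _ => rfl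
    ext w
    simp only [Finset.mem_filter, Finset.mem_univ, true_and] at hj ⊢
    constructor
    · exact fun h => h.2
    · rintro rfl
      exact ⟨hj, rfl⟩
  calc ∑ w with v ≤ w, a' w ≤ ∑ w with v i ≤ w i, a' w :=
        Finset.sum_le_sum_of_subset fun w hw => by
          simp only [Finset.mem_filter, Finset.mem_univ, true_and] at hw ⊢
          exact hw i
    _ = ∑ w with v i ≤ w i, a w := by rw [key, key, h]
    _ = ∑ w with v ≤ w, a w := by
        symm
        refine Finset.sum_subset (fun w hw => ?_) fun w hw hw' => ?_
        · simp only [Finset.mem_filter, Finset.mem_univ, true_and] at hw ⊢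
          exact hw i
        · simp only [Finset.mem_filter, Finset.mem_univ, true_and] at hw hw'
          by_contra h0
          exact hw' (hi w (Finsupp.mem_support_iff.2 h0) hw)

/-- The masses of all principal up-sets agree, and they determine the vector by induction from the
top of the box. -/
theorem exponent_injOn (hn : 0 < n) :
    Set.InjOn (exponent b) {a | IsChainSupported a} := by
  classical
  intro a ha a' ha' h
  have hA (v : Box b) : ∑ w with v ≤ w, a w = ∑ w with v ≤ w, a' w :=
    le_antisymm (sum_upperSet_le hn ha' h.symm v) (sum_upperSet_le hn ha h v)
  ext v
  induction v using WellFoundedGT.induction with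
  | ind v ih =>
    have hsplit (c : Box b →₀ ℕ) : ∑ w with v ≤ w, c w = c v + ∑ w with v < w, c w := by
      rw [← Finset.sum_insert (by simp)]
      refine Finset.sum_congr ?_ fun _ _ => rfl
      ext w
      simp [le_iff_eq_or_lt, eq_comm]
    have h1 := hA v
    have h2 : ∑ w with v < w, a w = ∑ w with v < w, a' w :=
      Finset.sum_congr rfl fun w hw => ih w (by simpa using hw)
    rw [hsplit, hsplit, h2] at h1
    omega

/-- The infimum and the supremum of an incomparable pair yield a smaller exponent vector than the
pair itself. -/
theorem toDRL_inf_add_sup_lt {L : LinearOrder (Box b)} (hL : IsDiagonal L)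
    {v w : Box b} (h1 : ¬ v ≤ w) (h2 : ¬ w ≤ v) :
    DegRevLex.toDRL L (Finsupp.single (v ⊓ w) 1 + Finsupp.single (v ⊔ w) 1) <
      DegRevLex.toDRL L (Finsupp.single v 1 + Finsupp.single w 1) := by
  classical
  have hiv : v ⊓ w ≠ v := fun h => h1 (inf_eq_left.1 h)
  have hiw : v ⊓ w ≠ w := fun h => h2 (inf_eq_right.1 h)
  have hsv : v ⊔ w ≠ v := fun h => h2 (sup_eq_left.1 h)
  have hsw : v ⊔ w ≠ w := fun h => h1 (sup_eq_right.1 h)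
  refine (DegRevLex.lt_iff L).2 (Or.inr ⟨by simp, ?_⟩)
  -- The deciding variable `x` is the smallest of the four under `L`: the infimum for a linear
  -- extension, the supremum for an extension of the opposite order.
  have aux (x : Box b) (hxv : x ≠ v) (hxw : x ≠ w) (hx : x = v ⊓ w ∨ x = v ⊔ w)
      (lv : L.le x v) (lw : L.le x w) (li : L.le x (v ⊓ w)) (ls : L.le x (v ⊔ w)) :
      ∃ y, (∀ z, L.lt z y →
        (Finsupp.single (v ⊓ w) 1 + Finsupp.single (v ⊔ w) 1 : Box b →₀ ℕ) z =
        (Finsupp.single v 1 + Finsupp.single w 1 : Box b →₀ ℕ) z) ∧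
        (Finsupp.single v 1 + Finsupp.single w 1 : Box b →₀ ℕ) y <
        (Finsupp.single (v ⊓ w) 1 + Finsupp.single (v ⊔ w) 1 : Box b →₀ ℕ) y := by
    refine ⟨x, fun z hz => ?_, ?_⟩
    · have hne {y : Box b} (hy : L.le x y) : y ≠ z := by
        rintro rfl
        exact absurd hy ((L.lt_iff_le_not_ge _ _).1 hz).2
      simp [hne lv, hne lw, hne li, hne ls]
    · rcases hx with rfl | rfl
      · simp [Finsupp.single_apply, hxv.symm, hxw.symm]
      · simp [Finsupp.single_apply, hxv.symm, hxw.symm]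
  rcases hL with hL | hL
  · have hv : v ⊓ w ≤ v := inf_le_left
    have hw : v ⊓ w ≤ w := inf_le_right
    have hs : v ⊓ w ≤ v ⊔ w := inf_le_sup
    exact aux (v ⊓ w) hiv hiw (Or.inl rfl) (hL _ _ hv) (hL _ _ hw) (L.le_refl _) (hL _ _ hs)
  · have hv : v ≤ v ⊔ w := le_sup_left
    have hw : w ≤ v ⊔ w := le_sup_right
    have hs : v ⊓ w ≤ v ⊔ w := inf_le_sup
    exact aux (v ⊔ w) hsv hsw (Or.inr rfl) (hL _ _ hv) (hL _ _ hw) (hL _ _ hs) (L.le_refl _)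

theorem exists_incomparable {s : Finset (Box b)} (hs : ¬ IsChain (· ≤ ·) (s : Set (Box b))) :
    ∃ v ∈ s, ∃ w ∈ s, ¬ v ≤ w ∧ ¬ w ≤ v := by
  by_contra! hcon
  refine hs fun v hv w hw _ => ?_
  by_cases h : v ≤ w
  · exact Or.inl h
  · exact Or.inr (hcon v hv w hw h)

theorem single_add_single_le {c : Box b →₀ ℕ} {v w : Box b} (hv : v ∈ c.support)
    (hw : w ∈ c.support) (hne : v ≠ w) :
    Finsupp.single v 1 + Finsupp.single w 1 ≤ c := by
  classical
  intro x
  have h1 : c v ≠ 0 := Finsupp.mem_support_iff.1 hv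
  have h2 : c w ≠ 0 := Finsupp.mem_support_iff.1 hw
  simp only [Finsupp.add_apply, Finsupp.single_apply]
  by_cases hx : v = x
  · subst hx
    simp [hne.symm]
    omega
  · by_cases hx' : w = x
    · subst hx'
      simp [hne]
      omega
    · simp [hx, hx']

/-- Each fibre of the exponent map contains a chain supported vector that is a lower bound of the
fibre. -/
theorem exists_isChainSupported_le {L : LinearOrder (Box b)} (hL : IsDiagonal L)
    (c : Box b →₀ ℕ) :
    ∃ a, IsChainSupported a ∧ exponent b a = exponent b c ∧
      DegRevLex.toDRL L a ≤ DegRevLex.toDRL L c := by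
  have := DegRevLex.wellFoundedLT (σ := Box b) L
  induction hc : DegRevLex.toDRL L c using WellFoundedLT.induction generalizing c with
  | ind d ih =>
    subst hc
    by_cases h : IsChainSupported c
    · exact ⟨c, h, rfl, le_rfl⟩
    obtain ⟨v, hv, w, hw, h1, h2⟩ := exists_incomparable h
    obtain ⟨r, rfl⟩ := exists_add_of_le (single_add_single_le hv hw fun h => h1 h.le)
    have hlt : DegRevLex.toDRL L (Finsupp.single (v ⊓ w) 1 + Finsupp.single (v ⊔ w) 1 + r) <
        DegRevLex.toDRL L (Finsupp.single v 1 + Finsupp.single w 1 + r) := by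
      have h3 := toDRL_inf_add_sup_lt hL h1 h2
      refine lt_of_le_of_ne ?_ fun h => h3.ne ?_
      · rw [map_add _ _ r, map_add _ _ r]
        exact add_le_add_left h3.le _
      · rw [add_right_cancel ((DegRevLex.toDRL L).injective h)]
    obtain ⟨a, ha, he, hle⟩ := ih _ hlt _ rfl
    refine ⟨a, ha, he.trans ?_, hle.trans hlt.le⟩
    simp only [map_add, exponent_single, one_smul, varExponent_inf_add_sup]

theorem toDRL_le_of_isChainSupported (hn : 0 < n) {L : LinearOrder (Box b)} (hL : IsDiagonal L)
    {a c : Box b →₀ ℕ} (ha : IsChainSupported a) (h : exponent b a = exponent b c) :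
    DegRevLex.toDRL L a ≤ DegRevLex.toDRL L c := by
  obtain ⟨a', ha', he, hle⟩ := exists_isChainSupported_le hL c
  rwa [exponent_injOn hn ha ha' (h.trans he.symm)]

/-! ### The initial ideal and the initial complex -/

/-- A chain supported leading exponent would be least in its fibre and greatest in the support of
`f`, hence alone in its fibre there; its coefficient could not cancel in the image. -/
theorem not_isChainSupported_degree (hn : 0 < n) {L : LinearOrder (Box b)} (hL : IsDiagonal L)
    {k : Type*} [Field k] {f : MvPolynomial (Box b) k} (hf : f ∈ segreIdeal k b) (hf0 : f ≠ 0) :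
    ¬ IsChainSupported ((degRevLex L).degree f) := by
  intro hch
  have hmem := ((degRevLex L).degree_mem_support_iff f).2 hf0
  have h0 := congrArg (MvPolynomial.coeff (exponent b ((degRevLex L).degree f)))
    (mem_segreIdeal.1 hf)
  rw [coeff_param, Finset.sum_eq_single_of_mem _ hmem, if_pos rfl] at h0
  · exact MvPolynomial.mem_support_iff.1 hmem (by simpa using h0)
  · intro c hc hne
    refine if_neg fun he => hne ?_
    have h1 : DegRevLex.toDRL L ((degRevLex L).degree f) ≤ DegRevLex.toDRL L c :=
      toDRL_le_of_isChainSupported hn hL hch he.symm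
    have h2 : DegRevLex.toDRL L c ≤ DegRevLex.toDRL L ((degRevLex L).degree f) :=
      (degRevLex L).le_degree hc
    exact (DegRevLex.toDRL L).injective (le_antisymm h2 h1)

theorem monomial_mem_initialIdeal {L : LinearOrder (Box b)} (hL : IsDiagonal L)
    (k : Type*) [Field k] {v w : Box b} (h1 : ¬ v ≤ w) (h2 : ¬ w ≤ v) :
    MvPolynomial.monomial (Finsupp.single v 1 + Finsupp.single w 1) 1 ∈
      initialIdeal (degRevLex L) (segreIdeal k b) := by
  classical
  set p := (Finsupp.single v 1 + Finsupp.single w 1 : Box b →₀ ℕ)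
  set q := (Finsupp.single (v ⊓ w) 1 + Finsupp.single (v ⊔ w) 1 : Box b →₀ ℕ)
  have hlt : (degRevLex L).toSyn ((degRevLex L).degree (MvPolynomial.monomial q (1 : k))) <
      (degRevLex L).toSyn ((degRevLex L).degree (MvPolynomial.monomial p (1 : k))) := by
    simp only [MonomialOrder.degree_monomial, one_ne_zero, if_false]
    exact toDRL_inf_add_sup_lt hL h1 h2
  refine Ideal.subset_span ⟨MvPolynomial.monomial p 1 - MvPolynomial.monomial q 1, ?_, ?_⟩
  · rw [SetLike.mem_coe, mem_segreIdeal, map_sub, param_monomial, param_monomial, sub_eq_zero]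
    congr 1
    simp only [p, q, map_add, exponent_single, one_smul, varExponent_inf_add_sup]
  · rw [MonomialOrder.leadingTerm, MonomialOrder.degree_sub_of_lt hlt,
      MonomialOrder.leadingCoeff_sub_of_lt hlt]
    exact MonomialOrder.leadingTerm_monomial _ _

theorem initialIdeal_le_span (hn : 0 < n) {L : LinearOrder (Box b)} (hL : IsDiagonal L)
    (k : Type*) [Field k] :
    initialIdeal (degRevLex L) (segreIdeal k b) ≤
      Ideal.span ((fun a => MvPolynomial.monomial a (1 : k)) ''
        {a : Box b →₀ ℕ | ¬ IsChainSupported a}) := by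
  refine Ideal.span_le.2 ?_
  rintro _ ⟨f, hf, rfl⟩
  by_cases hf0 : f = 0
  · simp [hf0]
  · rw [SetLike.mem_coe, MvPolynomial.mem_ideal_span_monomial_image]
    intro c hc
    refine ⟨_, not_isChainSupported_degree hn hL hf hf0, ?_⟩
    have := MvPolynomial.support_monomial_subset hc
    exact (Finset.mem_singleton.1 this).ge

/-- The initial complex of the Segre ideal is the order complex of the box. -/
theorem mem_initialComplex_iff (hn : 0 < n) {L : LinearOrder (Box b)} (hL : IsDiagonal L)
    {k : Type*} [Field k] {s : Finset (Box b)} :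
    s ∈ initialComplex (degRevLex L) (segreIdeal k b) ↔ IsChain (· ≤ ·) (s : Set (Box b)) := by
  classical
  have hprod : ∏ v ∈ s, (MvPolynomial.X v : MvPolynomial (Box b) k) =
      MvPolynomial.monomial (∑ v ∈ s, Finsupp.single v 1) 1 := by
    rw [MvPolynomial.monomial_sum_one]
    rfl
  have hval (x : Box b) : (∑ v ∈ s, Finsupp.single v 1 : Box b →₀ ℕ) x =
      if x ∈ s then 1 else 0 := by
    simp [Finsupp.finsetSum_apply, Finsupp.single_apply]
  rw [initialComplex, Set.mem_ofPred_eq, hprod]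
  constructor
  · intro h
    by_contra hs
    obtain ⟨v, hv, w, hw, h1, h2⟩ := exists_incomparable hs
    refine h (Ideal.le_radical ?_)
    have hle : Finsupp.single v 1 + Finsupp.single w 1 ≤
        (∑ v ∈ s, Finsupp.single v 1 : Box b →₀ ℕ) := by
      refine single_add_single_le ?_ ?_ fun h => h1 h.le
      · simp [Finsupp.mem_support_iff, hval, hv]
      · simp [Finsupp.mem_support_iff, hval, hw]
    obtain ⟨r, hr⟩ := exists_add_of_le hle
    rw [hr, ← one_mul (1 : k), ← MvPolynomial.monomial_mul]
    exact Ideal.mul_mem_right _ _ (monomial_mem_initialIdeal hL k h1 h2)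
  -- A power of the squarefree monomial on `s` would be divisible by a monomial whose support is not
  -- a chain, yet that support lies in `s`.
  · rintro hs ⟨m, hm⟩
    have h1 := initialIdeal_le_span hn hL k hm
    rw [MvPolynomial.monomial_pow, one_pow, MvPolynomial.mem_ideal_span_monomial_image] at h1
    obtain ⟨a, ha, hle⟩ := h1 _ (by 
      rw [MvPolynomial.support_monomial, if_neg one_ne_zero]
      exact Finset.mem_singleton_self _)
    refine ha (hs.mono fun x hx => ?_)
    by_contra hxs
    have h2 := hle x
    rw [Finsupp.smul_apply, hval, if_neg (by simpa using hxs)] at h2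
    exact Finsupp.mem_support_iff.1 hx (by simpa using h2)

end Segre

/-! ### Lattice paths as maximal chains -/

namespace MultisetPerm

variable {n : ℕ} {b : Fin n → ℕ}

theorem val_point (u : MultisetPerm b) (m : ℕ) (i : Fin n) :
    (u.point m i : ℕ) = (Finset.univ.filter fun l => l.val < m ∧ u.1 l = i).card := rfl

theorem sum_point (u : MultisetPerm b) {m : ℕ} (hm : m ≤ ∑ i, b i) :
    ∑ i, (u.point m i : ℕ) = m := by
  have h := Finset.card_eq_sum_card_fiberwise (f := u.1)
    (s := Finset.univ.filter fun l => l.val < m) (t := Finset.univ) (by simp)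
  simp only [Finset.filter_filter] at h
  simp only [val_point, ← h]
  simp [Fin.card_filter_val_lt, hm]

theorem point_mono (u : MultisetPerm b) : Monotone u.point := by
  intro m m' h i
  rw [Fin.le_def, val_point, val_point]
  refine Finset.card_le_card fun l hl => ?_
  simp only [Finset.mem_filter, Finset.mem_univ, true_and] at hl ⊢
  exact ⟨hl.1.trans_le h, hl.2⟩

theorem point_injOn (u : MultisetPerm b) : Set.InjOn u.point (Set.Iic (∑ i, b i)) := by
  intro m hm m' hm' h
  rw [← u.sum_point hm, ← u.sum_point hm', h]

theorem mem_latticePath {u : MultisetPerm b} {v : Box b} :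
    v ∈ u.latticePath ↔ ∃ m ≤ ∑ i, b i, u.point m = v := by
  simp [latticePath]

theorem point_sum_of_mem_latticePath {u : MultisetPerm b} {v : Box b} (h : v ∈ u.latticePath) :
    u.point (∑ i, (v i : ℕ)) = v := by
  obtain ⟨m, hm, rfl⟩ := mem_latticePath.1 h
  rw [u.sum_point hm]

theorem card_latticePath (u : MultisetPerm b) : u.latticePath.card = ∑ i, b i + 1 := by
  rw [latticePath, Finset.card_image_of_injOn, Finset.card_range]
  exact u.point_injOn.mono fun m hm => by simpa [Nat.lt_succ_iff] using hm

theorem card_descentPoints (u : MultisetPerm b) : u.descentPoints.card = u.desc := by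
  rw [descentPoints, Finset.card_image_of_injOn, desc]
  refine u.point_injOn.mono fun m hm => ?_
  have := (Finset.mem_filter.1 (Finset.mem_coe.1 hm)).1
  exact (Finset.mem_range.1 this).le

theorem descentPoints_subset_latticePath (u : MultisetPerm b) :
    u.descentPoints ⊆ u.latticePath := by
  refine Finset.image_subset_image fun m hm => ?_
  have := Finset.mem_range.1 (Finset.mem_filter.1 hm).1
  exact Finset.mem_range.2 (by omega)

theorem isChain_latticePath (u : MultisetPerm b) :
    IsChain (· ≤ ·) (u.latticePath : Set (Box b)) := by
  intro v hv w hw _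
  obtain ⟨m, -, rfl⟩ := mem_latticePath.1 (Finset.mem_coe.1 hv)
  obtain ⟨m', -, rfl⟩ := mem_latticePath.1 (Finset.mem_coe.1 hw)
  rcases le_total m m' with h | h
  · exact Or.inl (u.point_mono h)
  · exact Or.inr (u.point_mono h)

theorem eq_of_le_of_sum_eq {v w : Box b} (h : v ≤ w) (hs : ∑ i, (v i : ℕ) = ∑ i, (w i : ℕ)) :
    v = w := by
  funext i
  exact Fin.ext ((Finset.sum_eq_sum_iff_of_le fun i _ => h i).1 hs i (Finset.mem_univ i))

/-- A path has a point of every rank, and comparable points of equal rank coincide. -/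
theorem maximal_latticePath (u : MultisetPerm b) :
    Maximal (fun s : Finset (Box b) => IsChain (· ≤ ·) (s : Set (Box b))) u.latticePath := by
  refine ⟨u.isChain_latticePath, fun s hs hle v hv => ?_⟩
  have hr : ∑ i, (v i : ℕ) ≤ ∑ i, b i :=
    Finset.sum_le_sum fun i _ => Nat.le_of_lt_succ (v i).2
  have hp : u.point (∑ i, (v i : ℕ)) ∈ u.latticePath := mem_latticePath.2 ⟨_, hr, rfl⟩
  have hsum := u.sum_point hr
  rcases hs.total (hle hp) hv with h | h
  · rwa [eq_of_le_of_sum_eq h hsum] at hp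
  · rwa [← eq_of_le_of_sum_eq h hsum.symm] at hp

/-! ### Disjointness of the intervals -/

theorem not_lt_at_first_difference {u u' : MultisetPerm b} {H : Finset (Box b)}
    (hu : H ⊆ u.latticePath) (hu' : u'.descentPoints ⊆ H) {m : Fin (∑ i, b i)}
    (hm : ∀ l < m, u.1 l = u'.1 l) : ¬ u.1 m < u'.1 m := by
  -- Put `a = u m`. Both words contain `a` equally often, so `u'` must use `a` after position `m`;
  -- `p` is the first such position.
  intro hlt
  have hp : ∃ p, m < p ∧ u'.1 p = u.1 m := by
    by_contra! hcon
    have hss : (Finset.univ.filter fun l => u'.1 l = u.1 m) ⊂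
        Finset.univ.filter fun l => u.1 l = u.1 m := by
      refine Finset.ssubset_iff_subset_ne.2 ⟨fun l hl => ?_, fun h => ?_⟩
      · simp only [Finset.mem_filter, Finset.mem_univ, true_and] at hl ⊢
        rcases lt_trichotomy l m with h | rfl | h
        · rw [hm l h, hl]
        · rfl
        · exact absurd hl (hcon l h)
      · have : m ∈ Finset.univ.filter fun l => u'.1 l = u.1 m := by
          rw [h]
          simp
        exact hlt.ne' (by simpa using this)
    have := Finset.card_lt_card hss
    rw [u.2, u'.2] at this
    exact lt_irrefl _ this
  obtain ⟨p, ⟨hmp, hpa⟩, hmin⟩ := WellFounded.has_min (wellFounded_lt (α := Fin (∑ i, b i)))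
    {p | m < p ∧ u'.1 p = u.1 m} hp
  -- Since `u' m > a = u' p`, the word `u'` descends somewhere between `m` and `p`.
  have hq : ∃ q r : Fin (∑ i, b i), m ≤ r ∧ q ≤ p ∧ r.val + 1 = q.val ∧ u'.1 q < u'.1 r := by
    by_contra! hcon
    have hmono (t : ℕ) (ht : m.val + t ≤ p.val) :
        u'.1 m ≤ u'.1 ⟨m.val + t, ht.trans_lt p.2⟩ := by
      induction t with
      | zero => exact le_rfl
      | succ t ih =>
        refine (ih (by omega)).trans (hcon ⟨m.val + (t + 1), _⟩ _ ?_ ?_ ?_)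
        · rw [Fin.le_def]
          simp
        · rw [Fin.le_def]
          exact ht
        · simp [add_assoc]
    have h1 := hmono (p.val - m.val) (by rw [Fin.lt_def] at hmp; omega)
    have h2 : (⟨m.val + (p.val - m.val), by rw [Fin.lt_def] at hmp; omega⟩ :
        Fin (∑ i, b i)) = p := Fin.ext (by rw [Fin.lt_def] at hmp; simp; omega)
    rw [h2, hpa] at h1
    exact absurd hlt h1.not_gt
  obtain ⟨q, r, hmr, hqp, hrq, hdesc⟩ := hq
  have hmem : u'.point q ∈ u.latticePath := hu (hu' (Finset.mem_image_of_mem _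
    (Finset.mem_filter.2 ⟨Finset.mem_range.2 q.2, r, q, hrq, rfl, hdesc⟩)))
  have heq := point_sum_of_mem_latticePath hmem
  rw [u'.sum_point q.2.le] at heq
  have hval := congrArg Fin.val (congrFun heq (u.1 m))
  rw [val_point, val_point] at hval
  -- The descent point lies on the path of `u`, hence is its point of rank `q`. But within `q` steps
  -- `u` has used `a` more often, namely at position `m`.
  have hss : (Finset.univ.filter fun l : Fin (∑ i, b i) => l.val < q.val ∧ u'.1 l = u.1 m) ⊂
      Finset.univ.filter fun l : Fin (∑ i, b i) => l.val < q.val ∧ u.1 l = u.1 m := by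
    have hmq : m.val < q.val := by
      rw [Fin.le_def] at hmr
      omega
    refine Finset.ssubset_iff_subset_ne.2 ⟨fun l hl => ?_, fun h => ?_⟩
    · simp only [Finset.mem_filter, Finset.mem_univ, true_and] at hl ⊢
      refine ⟨hl.1, ?_⟩
      rcases lt_trichotomy l m with h | rfl | h
      · rw [hm l h, hl.2]
      · rfl
      · exact absurd ((Fin.lt_def.2 hl.1).trans_le hqp) (hmin l ⟨h, hl.2⟩)
    · have : m ∈ Finset.univ.filter
          fun l : Fin (∑ i, b i) => l.val < q.val ∧ u'.1 l = u.1 m := by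
        rw [h]
        exact Finset.mem_filter.2 ⟨Finset.mem_univ _, hmq, rfl⟩
      exact hlt.ne' (Finset.mem_filter.1 this).2.2
  exact (Finset.card_lt_card hss).ne' hval

theorem disjoint_Icc {u u' : MultisetPerm b} (h : u ≠ u') :
    Disjoint (Set.Icc u.descentPoints u.latticePath)
      (Set.Icc u'.descentPoints u'.latticePath) := by
  rw [Set.disjoint_left]
  rintro H ⟨h1, h2⟩ ⟨h1', h2'⟩
  have hne : {l | u.1 l ≠ u'.1 l}.Nonempty := by
    by_contra hcon
    refine h (Subtype.ext (funext fun l => ?_))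
    by_contra hl
    exact hcon ⟨l, hl⟩
  obtain ⟨m, hm, hmin⟩ := WellFounded.has_min (wellFounded_lt (α := Fin (∑ i, b i))) _ hne
  have hag (l) (hl : l < m) : u.1 l = u'.1 l := by
    by_contra hcon
    exact hmin l hcon hl
  rcases lt_or_gt_of_ne hm with hlt | hlt
  · exact not_lt_at_first_difference h2 h1' hag hlt
  · exact not_lt_at_first_difference h2' h1 (fun l hl => (hag l hl).symm) hlt

/-! ### Every chain lies in an interval -/

theorem exists_equiv_strictMono {α κ : Type*} [Fintype α] [LinearOrder κ] {N : ℕ}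
    (hN : Fintype.card α = N) {f : α → κ} (hf : Function.Injective f) :
    ∃ e : Fin N ≃ α, StrictMono (f ∘ e) := by
  let _ := LinearOrder.lift' f hf
  exact ⟨(monoEquivOfFin α hN).toEquiv, fun x y hxy => (monoEquivOfFin α hN).strictMono hxy⟩

theorem mem_iff_lt_card_of_isLowerSet {N : ℕ} {A : Finset (Fin N)}
    (hA : IsLowerSet (A : Set (Fin N))) (l : Fin N) : l ∈ A ↔ l.val < A.card := by
  constructor
  · intro h
    have : Finset.Iic l ⊆ A := fun x hx => hA (Finset.mem_Iic.1 hx) h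
    have := Finset.card_le_card this
    rw [Fin.card_Iic] at this
    omega
  · intro h
    by_contra hl
    have : A ⊆ Finset.Iio l := fun x hx => by
      rw [Finset.mem_Iio]
      by_contra hlx
      exact hl (hA (not_lt.1 hlx) hx)
    have := Finset.card_le_card this
    rw [Fin.card_Iio] at this
    omega

theorem card_sigma_fst_eq_val_lt (i : Fin n) {x : ℕ} (hx : x ≤ b i) :
    (Finset.univ.filter fun p : (i : Fin n) × Fin (b i) => p.1 = i ∧ p.2.val < x).card = x := by
  classical
  have : (Finset.univ.filter fun p : (i : Fin n) × Fin (b i) => p.1 = i ∧ p.2.val < x) =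
      (Finset.univ.filter fun c : Fin (b i) => c.val < x).map
        (Function.Embedding.sigmaMk (β := fun i => Fin (b i)) i) := by
    ext ⟨i', c⟩
    simp only [Finset.mem_filter, Finset.mem_univ, true_and, Finset.mem_map,
      Function.Embedding.sigmaMk_apply]
    constructor
    · rintro ⟨rfl, h⟩
      exact ⟨c, h, rfl⟩
    · rintro ⟨c', h, heq⟩
      cases heq
      exact ⟨rfl, h⟩
  rw [this, Finset.card_map, Fin.card_filter_val_lt, min_eq_right hx]

/-- Every chain lies in the interval of some multiset permutation: the unit steps `(i, c)` from
`c` to `c + 1` in direction `i` are sorted first by the number of elements `v` of the chain with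
`v i ≤ c`, then by `i`. -/
theorem exists_mem_Icc {H : Finset (Box b)} (hH : IsChain (· ≤ ·) (H : Set (Box b))) :
    ∃ u : MultisetPerm b, H ∈ Set.Icc u.descentPoints u.latticePath := by
  classical
  -- `S p` consists of the members of the chain that have not yet made the step `p`. The last entry
  -- of the key `f` only serves to make it injective.
  let S (p : (i : Fin n) × Fin (b i)) : Finset (Box b) := H.filter fun v => (v p.1).val ≤ p.2.val
  let f (p : (i : Fin n) × Fin (b i)) : ℕ ×ₗ (Fin n ×ₗ ℕ) :=
    toLex ((S p).card, toLex (p.1, p.2.val))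
  have hf : Function.Injective f := by
    rintro ⟨i, c⟩ ⟨i', c'⟩ h
    simp only [f, EmbeddingLike.apply_eq_iff_eq, Prod.mk.injEq] at h
    obtain ⟨-, rfl, hc⟩ := h
    rw [Fin.ext hc]
  obtain ⟨e, he⟩ := exists_equiv_strictMono (N := ∑ i, b i) (by simp) hf
  have hcount (P : (i : Fin n) × Fin (b i) → Prop) [DecidablePred P] :
      (Finset.univ.filter fun l => P (e l)).card = (Finset.univ.filter P).card := by
    rw [← Finset.card_map e.toEmbedding]
    congr 1
    ext p
    simp only [Finset.mem_map, Finset.mem_filter, Finset.mem_univ, true_and,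
      Equiv.coe_toEmbedding]
    exact ⟨fun ⟨l, h, hl⟩ => hl ▸ h, fun h => ⟨e.symm p, by simpa using h, by simp⟩⟩
  -- `S p` is an initial segment of the chain, so its size tells whether it contains `v`.
  have hS {v : Box b} (hv : v ∈ H) (p : (i : Fin n) × Fin (b i)) :
      p.2.val < (v p.1).val ↔ (S p).card < (H.filter fun w => w ≤ v).card := by
    constructor
    · intro h
      refine Finset.card_lt_card (Finset.ssubset_iff_subset_ne.2 ⟨fun w hw => ?_, fun heq => ?_⟩)
      · obtain ⟨hw, hwp⟩ := Finset.mem_filter.1 hw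
        refine Finset.mem_filter.2 ⟨hw, (hH.total hw hv).resolve_right fun hvw => ?_⟩
        have := Fin.le_def.1 (hvw p.1)
        omega
      · have : v ∈ S p := heq ▸ Finset.mem_filter.2 ⟨hv, le_rfl⟩
        have := (Finset.mem_filter.1 this).2
        omega
    · intro h
      by_contra hlt
      refine h.not_ge (Finset.card_le_card fun w hw => ?_)
      obtain ⟨hw, hwv⟩ := Finset.mem_filter.1 hw
      have := Fin.le_def.1 (hwv p.1)
      exact Finset.mem_filter.2 ⟨hw, by omega⟩
  -- The steps leading to `v` therefore come first in the sorted order, and their number is the rank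
  -- of `v`.
  have hseg {v : Box b} (hv : v ∈ H) (l : Fin (∑ i, b i)) :
      (e l).2.val < (v (e l).1).val ↔ l.val < ∑ i, (v i : ℕ) := by
    have hlow : IsLowerSet ((Finset.univ.filter fun l => (e l).2.val < (v (e l).1).val :
        Finset (Fin (∑ i, b i))) : Set (Fin (∑ i, b i))) := by
      intro x y hyx hx
      simp only [Finset.coe_filter, Finset.mem_univ, true_and, Set.mem_ofPred_eq] at hx ⊢
      rw [hS hv] at hx ⊢
      refine lt_of_le_of_lt ?_ hx
      rcases Prod.Lex.toLex_le_toLex.1 (he.monotone hyx) with h | h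
      · exact h.le
      · exact h.1.le
    have hcard : (Finset.univ.filter fun l => (e l).2.val < (v (e l).1).val).card =
        ∑ i, (v i : ℕ) := by
      rw [hcount fun p => p.2.val < (v p.1).val,
        Finset.card_eq_sum_card_fiberwise (f := Sigma.fst) (t := Finset.univ) (by simp)]
      refine Finset.sum_congr rfl fun i _ => ?_
      rw [Finset.filter_filter, ← card_sigma_fst_eq_val_lt i (Nat.le_of_lt_succ (v i).2)]
      congr 1
      ext ⟨i', c⟩
      simp only [Finset.mem_filter, Finset.mem_univ, true_and]
      constructor
      · rintro ⟨h, rfl⟩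
        exact ⟨rfl, h⟩
      · rintro ⟨rfl, h⟩
        exact ⟨h, rfl⟩
    rw [← hcard, ← mem_iff_lt_card_of_isLowerSet hlow]
    simp
  let u : MultisetPerm b := ⟨fun l => (e l).1, fun i => by
    change (Finset.univ.filter fun l => (e l).1 = i).card = b i
    rw [hcount fun p => p.1 = i]
    refine Eq.trans ?_ (card_sigma_fst_eq_val_lt i (le_refl (b i)))
    congr 1
    ext ⟨i', c⟩
    simp only [Finset.mem_filter, Finset.mem_univ, true_and]
    constructor
    · rintro rfl
      exact ⟨rfl, c.2⟩
    · exact fun h => h.1⟩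
  have hpoint {v : Box b} (hv : v ∈ H) : u.point (∑ i, (v i : ℕ)) = v := by
    funext i
    refine Fin.ext ?_
    rw [val_point, ← card_sigma_fst_eq_val_lt i (Nat.le_of_lt_succ (v i).2),
      ← hcount fun p => p.1 = i ∧ p.2.val < (v i).val]
    congr 1
    ext l
    simp only [Finset.mem_filter, Finset.mem_univ, true_and, u, ← hseg hv]
    constructor
    · rintro ⟨h, rfl⟩
      exact ⟨rfl, h⟩
    · rintro ⟨rfl, h⟩
      exact ⟨h, rfl⟩
  refine ⟨u, fun x hx => ?_, fun v hv => mem_latticePath.2 ⟨_, ?_, hpoint hv⟩⟩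
  · obtain ⟨m, hm, rfl⟩ := Finset.mem_image.1 hx
    obtain ⟨-, p, q, hp, hq, hlt⟩ := Finset.mem_filter.1 hm
    -- The key increases while the symbol drops, so the first entry must jump. A chain member
    -- responsible for the jump has made step `p` but not step `q`, so its rank is `m`.
    have hSlt : (S (e p)).card < (S (e q)).card := by
      have hpq : p < q := Fin.lt_def.2 (by omega)
      rcases Prod.Lex.toLex_lt_toLex.1 (he hpq) with h | ⟨-, h⟩
      · exact h
      · rcases Prod.Lex.toLex_lt_toLex.1 h with h | ⟨h, -⟩
        · exact absurd hlt h.not_gt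
        · exact absurd h hlt.ne'
    obtain ⟨v, hv, hvp⟩ := Finset.exists_mem_notMem_of_card_lt_card hSlt
    obtain ⟨hvH, hvq⟩ := Finset.mem_filter.1 hv
    have h1 : p.val < ∑ i, (v i : ℕ) := (hseg hvH p).1 (by
      by_contra hcon
      exact hvp (Finset.mem_filter.2 ⟨hvH, not_lt.1 hcon⟩))
    have h2 : ¬ q.val < ∑ i, (v i : ℕ) := fun h => absurd ((hseg hvH q).2 h) (by omega)
    have h3 : m = ∑ i, (v i : ℕ) := by omega
    rw [h3, hpoint hvH]
    exact hvH
  · exact Finset.sum_le_sum fun i _ => Nat.le_of_lt_succ (v i).2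

end MultisetPerm

/-! ### Counting and the Hilbert series -/

/-- This moves the dimension count from the quotient to the image of `param`, where distinct
monomials are independent. -/
theorem LinearMap.finrank_map_eq_of_ker_eq {k V W W' : Type*} [Field k] [AddCommGroup V]
    [Module k V] [AddCommGroup W] [Module k W] [AddCommGroup W'] [Module k W']
    {f : V →ₗ[k] W} {g : V →ₗ[k] W'} (h : LinearMap.ker f = LinearMap.ker g)
    (M : Submodule k V) : Module.finrank k (M.map f) = Module.finrank k (M.map g) := by
  rw [← LinearMap.range_domRestrict, ← LinearMap.range_domRestrict]
  have h' : LinearMap.ker (f.domRestrict M) = LinearMap.ker (g.domRestrict M) := by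
    rw [LinearMap.ker_domRestrict, LinearMap.ker_domRestrict, h]
  exact (((f.domRestrict M).quotKerEquivRange.symm.trans
    (Submodule.quotEquivOfEq _ _ h')).trans (g.domRestrict M).quotKerEquivRange).finrank_eq

/-- The exponent vectors of degree `l` whose support lies between `G` and `F` are counted by a
binomial coefficient. -/
theorem Finset.card_filter_finsuppAntidiag {σ : Type*} [DecidableEq σ] {G F : Finset σ}
    (hGF : G ⊆ F) {N : ℕ} (hF : F.card = N + 1) (l : ℕ) :
    ((F.finsuppAntidiag l).filter fun a => G ⊆ a.support).card =
      if G.card ≤ l then (N + (l - G.card)).choose N else 0 := by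
  set g : σ →₀ ℕ := ∑ v ∈ G, Finsupp.single v 1 with hg
  have hval (x : σ) : g x = if x ∈ G then 1 else 0 := by
    simp [hg, Finsupp.finsetSum_apply, Finsupp.single_apply]
  have hsum : ∑ x ∈ F, g x = G.card := by
    simp only [hval, Finset.sum_boole, Finset.filter_mem_eq_inter]
    rw [Finset.inter_eq_right.2 hGF]
    rfl
  have hle {a : σ →₀ ℕ} (ha : G ⊆ a.support) : g ≤ a := by
    intro x
    rw [hval]
    split_ifs with hx
    · exact Nat.one_le_iff_ne_zero.2 (Finsupp.mem_support_iff.1 (ha hx))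
    · exact Nat.zero_le _
  have hadd (c : σ →₀ ℕ) : F.sum ⇑(c + g) = F.sum c + G.card := by
    rw [← hsum, ← Finset.sum_add_distrib]
    rfl
  split_ifs with hl
  -- Subtracting the indicator `g` of `G` leaves an arbitrary vector of degree `l - G.card` on the
  -- `N + 1` points of `F`.
  · have heq : ((F.finsuppAntidiag l).filter fun a => G ⊆ a.support) =
        (F.finsuppAntidiag (l - G.card)).map (addRightEmbedding g) := by
      ext a
      simp only [Finset.mem_filter, Finset.mem_finsuppAntidiag, Finset.mem_map,
        addRightEmbedding_apply]
      constructor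
      · rintro ⟨⟨h1, h2⟩, h3⟩
        obtain ⟨c, rfl⟩ := exists_add_of_le (hle h3)
        refine ⟨c, ⟨?_, fun x hx => h2 ?_⟩, add_comm _ _⟩
        · rw [add_comm, hadd] at h1
          omega
        · simp only [Finsupp.mem_support_iff, Finsupp.add_apply] at hx ⊢
          omega
      · rintro ⟨c, ⟨h1, h2⟩, rfl⟩
        refine ⟨⟨?_, fun x hx => ?_⟩, fun x hx => ?_⟩
        · rw [hadd, h1]
          omega
        · by_contra hxF
          have hc : c x = 0 := Finsupp.notMem_support_iff.1 fun h => hxF (h2 h)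
          refine Finsupp.mem_support_iff.1 hx ?_
          rw [Finsupp.add_apply, hval, hc, if_neg fun h => hxF (hGF h), add_zero]
        · rw [Finsupp.mem_support_iff, Finsupp.add_apply, hval, if_pos hx]
          omega
    rw [heq, Finset.card_map, Finset.card_finsuppAntidiag_nat_eq_choose, hF,
      show N + 1 + (l - G.card) - 1 = N + (l - G.card) by omega, Nat.choose_symm_add]
  · refine Finset.card_eq_zero.2 (Finset.filter_eq_empty_iff.2 fun a ha hG => hl ?_)
    rw [← hsum, ← (Finset.mem_finsuppAntidiag.1 ha).1]
    exact Finset.sum_le_sum fun x _ => hle hG x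

namespace Segre

variable {n : ℕ} {b : Fin n → ℕ}

/-- The Hilbert function involves no term order, but straightening needs one to terminate. -/
theorem exists_isDiagonal (b : Fin n → ℕ) : ∃ L : LinearOrder (Box b), IsDiagonal L := by
  let L : LinearOrder (LinearExtension (Box b)) := inferInstance
  exact ⟨L, Or.inl fun _ _ h => (toLinearExtension (α := Box b)).monotone h⟩

open Classical in
/-- The chain supported exponent vectors of degree `l`. -/
noncomputable def chainExponents (b : Fin n → ℕ) (l : ℕ) : Finset (Box b →₀ ℕ) :=
  (Finset.univ.finsuppAntidiag l).filter IsChainSupported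

theorem mem_chainExponents {l : ℕ} {a : Box b →₀ ℕ} :
    a ∈ chainExponents b l ↔ a.degree = l ∧ IsChainSupported a := by
  simp [chainExponents, Finsupp.degree_eq_sum]

theorem map_param_homogeneousSubmodule (hn : 0 < n) (k : Type*) [Field k] (l : ℕ) :
    (MvPolynomial.homogeneousSubmodule (Box b) k l).map (param k b).toLinearMap =
      Submodule.span k (Set.range fun a : chainExponents b l =>
        MvPolynomial.monomial (exponent b a.1) (1 : k)) := by
  obtain ⟨L, hL⟩ := exists_isDiagonal b
  apply le_antisymm
  · rintro _ ⟨f, hf, rfl⟩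
    rw [AlgHom.toLinearMap_apply, f.as_sum, map_sum]
    refine Submodule.sum_mem _ fun c hc => ?_
    obtain ⟨a, ha, he, -⟩ := exists_isChainSupported_le hL c
    have hdeg : a.degree = l := by
      rw [degree_eq_sum_exponent ⟨0, hn⟩, he, ← degree_eq_sum_exponent]
      have h := (MvPolynomial.mem_homogeneousSubmodule _ _).1 hf
        (MvPolynomial.mem_support_iff.1 hc)
      rwa [Finsupp.degree_eq_weight_one]
    rw [param_monomial, ← he, ← mul_one (MvPolynomial.coeff c f), ← smul_eq_mul,
      ← MvPolynomial.smul_monomial]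
    exact Submodule.smul_mem _ _
      (Submodule.subset_span ⟨⟨a, mem_chainExponents.2 ⟨hdeg, ha⟩⟩, rfl⟩)
  · rw [Submodule.span_le]
    rintro _ ⟨a, rfl⟩
    exact ⟨MvPolynomial.monomial a.1 1, MvPolynomial.isHomogeneous_monomial _
      (mem_chainExponents.1 a.2).1, param_monomial k _ _⟩

theorem hilbertFunction_segreIdeal (hn : 0 < n) (k : Type*) [Field k] (l : ℕ) :
    hilbertFunction (segreIdeal k b) l = (chainExponents b l).card := by
  have hker : LinearMap.ker (Ideal.Quotient.mkₐ k (segreIdeal k b)).toLinearMap =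
      LinearMap.ker (param k b).toLinearMap := by
    ext f
    rw [LinearMap.mem_ker, LinearMap.mem_ker, AlgHom.toLinearMap_apply,
      AlgHom.toLinearMap_apply, ← mem_segreIdeal]
    exact Ideal.Quotient.eq_zero_iff_mem
  rw [hilbertFunction, LinearMap.finrank_map_eq_of_ker_eq hker,
    map_param_homogeneousSubmodule hn, finrank_span_eq_card, Fintype.card_coe]
  have hinj : Function.Injective fun a : chainExponents b l => exponent b a.1 :=
    fun a a' h => Subtype.ext (exponent_injOn hn (mem_chainExponents.1 a.2).2
      (mem_chainExponents.1 a'.2).2 h)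
  have := (MvPolynomial.basisMonomials ((i : Fin n) × Fin (b i + 1)) k).linearIndependent.comp
    _ hinj
  simpa [Function.comp_def] using this

/-- The vectors are sorted by the unique interval containing their support. -/
theorem card_chainExponents (b : Fin n → ℕ) (l : ℕ) :
    (chainExponents b l).card = ∑ u : MultisetPerm b,
      if u.desc ≤ l then (∑ i, b i + (l - u.desc)).choose (∑ i, b i) else 0 := by
  classical
  have heq : chainExponents b l = Finset.univ.biUnion fun u : MultisetPerm b =>
      (u.latticePath.finsuppAntidiag l).filter fun a => u.descentPoints ⊆ a.support := by
    ext a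
    have hdeg {F : Finset (Box b)} (hF : a.support ⊆ F) : ∑ x ∈ F, a x = a.degree :=
      (Finset.sum_subset hF fun x _ hx => Finsupp.notMem_support_iff.1 hx).symm
    simp only [mem_chainExponents, Finset.mem_biUnion, Finset.mem_univ, true_and,
      Finset.mem_filter, Finset.mem_finsuppAntidiag]
    constructor
    · rintro ⟨h1, h2⟩
      obtain ⟨u, hG, hF⟩ := MultisetPerm.exists_mem_Icc h2
      exact ⟨u, ⟨(hdeg hF).trans h1, hF⟩, hG⟩
    · rintro ⟨u, ⟨h1, h2⟩, -⟩
      exact ⟨(hdeg h2).symm.trans h1, u.isChain_latticePath.mono h2⟩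
  rw [heq, Finset.card_biUnion]
  · refine Finset.sum_congr rfl fun u _ => ?_
    rw [Finset.card_filter_finsuppAntidiag u.descentPoints_subset_latticePath
      u.card_latticePath, u.card_descentPoints]
  · intro u _ u' _ h
    refine Finset.disjoint_left.2 fun a ha ha' => ?_
    simp only [Finset.mem_filter, Finset.mem_finsuppAntidiag] at ha ha'
    exact Set.disjoint_left.1 (MultisetPerm.disjoint_Icc h) ⟨ha.2, ha.1.2⟩ ⟨ha'.2, ha'.1.2⟩

theorem hilbertSeries_mul_one_sub_pow (hn : 0 < n) (k : Type*) [Field k] (b : Fin n → ℕ) :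
    hilbertSeries (segreIdeal k b) * (1 - PowerSeries.X) ^ (∑ i, b i + 1) =
      (multisetEulerian b : PowerSeries ℤ) := by
  have h1 : hilbertSeries (segreIdeal k b) = (∑ u : MultisetPerm b, PowerSeries.X ^ u.desc) *
      PowerSeries.mk fun m => ((∑ i, b i + m).choose (∑ i, b i) : ℤ) := by
    ext l
    rw [hilbertSeries, PowerSeries.coeff_mk, hilbertFunction_segreIdeal hn, card_chainExponents,
      Finset.sum_mul, map_sum, Nat.cast_sum]
    refine Finset.sum_congr rfl fun u _ => ?_
    rw [PowerSeries.coeff_X_pow_mul']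
    split_ifs <;> simp
  have h2 : (multisetEulerian b : PowerSeries ℤ) =
      ∑ u : MultisetPerm b, PowerSeries.X ^ u.desc := by
    rw [multisetEulerian, ← Polynomial.coeToPowerSeries.ringHom_apply, map_sum]
    simp
  rw [h1, h2, mul_assoc, PowerSeries.mk_add_choose_mul_one_sub_pow_eq_one, mul_one]

theorem eval_one_multisetEulerian_ne_zero (b : Fin n → ℕ) :
    (multisetEulerian b).eval 1 ≠ 0 := by
  have h : (multisetEulerian b).eval 1 = Fintype.card (MultisetPerm b) := by
    simp [multisetEulerian, Polynomial.eval_finsetSum]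
  -- The empty chain lies in some interval, so a multiset permutation exists.
  obtain ⟨u, -⟩ := MultisetPerm.exists_mem_Icc (b := b) (H := ∅) (by simp)
  have : Nonempty (MultisetPerm b) := ⟨u⟩
  rw [h]
  exact_mod_cast Fintype.card_ne_zero

theorem coeff_multisetEulerian (b : Fin n → ℕ) (j : ℕ) :
    (multisetEulerian b).coeff j = (simonNewcomb b j : ℤ) := by
  simp [multisetEulerian, simonNewcomb, Polynomial.finsetSum_coeff, Polynomial.coeff_X_pow,
    eq_comm]

end Segre

theorem mainTheorem1 {k : Type*} [Field k] {n : ℕ} (hn : 0 < n) (b : Fin n → ℕ) :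
    (∀ L : LinearOrder (Box b), IsDiagonal L →
      (∀ u : MultisetPerm b, u.descentPoints ⊆ u.latticePath ∧
        Maximal (· ∈ initialComplex (degRevLex L) (segreIdeal k b)) u.latticePath) ∧
      initialComplex (degRevLex L) (segreIdeal k b) =
        ⋃ u : MultisetPerm b, Set.Icc u.descentPoints u.latticePath ∧
      Pairwise fun u u' : MultisetPerm b =>
        Disjoint (Set.Icc u.descentPoints u.latticePath)
          (Set.Icc u'.descentPoints u'.latticePath)) ∧
    hilbertSeries (segreIdeal k b) * (1 - PowerSeries.X) ^ (∑ i, b i + 1) =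
      (multisetEulerian b : PowerSeries ℤ) ∧
    IsHPolynomial (segreIdeal k b) (multisetEulerian b) (∑ i, b i + 1) ∧
    ∀ j, (multisetEulerian b).coeff j = (simonNewcomb b j : ℤ) := by
  refine ⟨fun L hL => ⟨fun u => ⟨u.descentPoints_subset_latticePath, ?_⟩, ?_,
      fun _ _ h => MultisetPerm.disjoint_Icc h⟩,
    Segre.hilbertSeries_mul_one_sub_pow hn k b,
    ⟨Segre.hilbertSeries_mul_one_sub_pow hn k b, Segre.eval_one_multisetEulerian_ne_zero b⟩,
    Segre.coeff_multisetEulerian b⟩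
  · simpa only [Segre.mem_initialComplex_iff hn hL] using u.maximal_latticePath
  · ext s
    rw [Segre.mem_initialComplex_iff hn hL, Set.mem_iUnion]
    exact ⟨MultisetPerm.exists_mem_Icc,
      fun ⟨u, _, hs⟩ => u.isChain_latticePath.mono (Finset.coe_subset.2 hs)⟩
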